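/- Let $(\mathcal X,\mathcal C)$ be a measurable space, let $L\ge 2$, and let $P_1,\dots,P_L$ be probability distributions on it that are \emph{jointly irreducible}: whenever $\sum_i\gamma_iP_i$ ($\gamma_i\in\mathbb R$) is a probability distribution, $\gamma_i\ge 0$ for all $i$. Let $\Pi=(\pi_{ij})$ be an $L\times L$ row-stochastic matrix ($\pi_{ij}\ge0$, $\sum_j\pi_{ij}=1$) of rank $L$, and let $\tilde P_i=\sum_j\pi_{ij}P_j$, $i=1,\dots,L$. For distributions $F_0,\dots,F_K$, let $$\kappa^*(F_0\mid F_1,\dots,F_K)=\max\Big\{\sum_{i=1}^K\nu_i:\ \nu_i\ge0,\ \sum_i\nu_i\le1,\ F_0=\Big(1-\sum_i\nu_i\Big)G+\sum_i\nu_iF_i\text{ for some probability distribution }G\Big\}.$$ A \emph{solution} of $\kappa^*(F_0\mid F_1,\dots,F_K)$ is a distribution $G=\dfrac{F_0-\sum_i\nu_iF_i}{1-\sum_i\nu_i}$ for a maximizing $\nu$ (with $\sum_i\nu_i<1$). For $K=1$ and $F_0\ne F_1$, write $\kappa=\kappa^*(F_0\mid F_1)$ and $\mathrm{Residue}(F_0\mid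 F_1)=\dfrac{F_0-\kappa F_1}{1-\kappa}$. $\mathrm{FaceTest}(Q_1,\dots,Q_K)$ returns $1$ if $\kappa^*(Q_i\mid Q_j)>0$ for all $i\ne j$, and $0$ otherwise. The recursive algorithm $\mathrm{Demix}(S_1,\dots,S_K)$, $K\ge2$, is as follows. - If $K=2$, return $\big(\mathrm{Residue}(S_1\mid S_2),\mathrm{Residue}(S_2\mid S_1)\big)$. - If $K\ge3$: 1. Draw $Q=\sum_{i=2}^Kw_iS_i$, where the weight vector $(w_2,\dots,w_K)$ is uniformly distributed on the simplex $\{w_i\ge0,\ \sum_iw_i=1\}$ and independent of the draws at the other levels of the recursion. (For affinely independent $S_2,\dots,S_K$ this is a uniformly distributed element of their convex hull.) 2. For $n=2,3,\dots$ compute $R_i=\mathrm{Residue}\big(\tfrac1nS_i+\tfrac{n-1}nQ\mid S_1\big)$ for $i=2,\dots,K$, and stop at the first $n$ for which $\mathrm{FaceTest}(R_2,\dots,R_K)$ returns $1$. 3. Let $(Q_1,\dots,Q_{K-1})=\mathrm{Demix}(R_2,\dots,R_K)$ for the $R_i$ of this last $n$. 4. Let $Q_K$ be any solution of $\kappa^*\big(\tfrac1K\sum_{i=1}^KS_i\mid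 Q_1,\dots,Q_{K-1}\big)$, and return $(Q_1,\dots,Q_K)$. Then, with probability $1$ over the random draws, $\mathrm{Demix}(\tilde P_1,\dots,\tilde P_L)$ terminates with an output (in particular, every residue it computes is that of two distinct distributions), and whichever solutions are chosen, every output is a permutation of $(P_1,\dots,P_L)$. -/

import Mathlib

open MeasureTheory

noncomputable section

namespace Demixing

variable {X : Type*} [MeasurableSpace X]

/-- A probability distribution on `X`, seen in the real vector space of signed measures. -/
def distr (P : ProbabilityMeasure X) : SignedMeasure X :=
  (P : Measure X).toSignedMeasure

/-- `P₁, …, P_L` are jointly irreducible: if a linear combination of them is a probability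
distribution, then all of its coefficients are nonnegative. -/
def JointlyIrreducible {L : ℕ} (P : Fin L → ProbabilityMeasure X) : Prop :=
  ∀ γ : Fin L → ℝ, (∃ H : ProbabilityMeasure X, ∑ i, γ i • distr (P i) = distr H) → ∀ i, 0 ≤ γ i

/-- The contaminated distributions `P̃ᵢ = ∑ⱼ πᵢⱼ Pⱼ`. -/
def contaminated {M L : ℕ} (Pi : Matrix (Fin M) (Fin L) ℝ) (P : Fin L → ProbabilityMeasure X) :
    Fin M → SignedMeasure X :=
  fun i => ∑ j, Pi i j • distr (P j)

/-- The two-sample operator `κ*(F₀ | F₁)`: the largest `κ ∈ [0,1]` such that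
`F₀ = (1 - κ) G + κ F₁` for some probability distribution `G`. -/
def kappa (F₀ F₁ : SignedMeasure X) : ℝ :=
  sSup {κ : ℝ | 0 ≤ κ ∧ κ ≤ 1 ∧
    ∃ G : ProbabilityMeasure X, F₀ = (1 - κ) • distr G + κ • F₁}

/-- The value `(F₀ - κ F₁) / (1 - κ)` with `κ = κ*(F₀ | F₁)`. It is meaningful for `F₀ ≠ F₁`; runs
of the algorithm below are required to use it for `F₀ ≠ F₁` only. -/
def residue (F₀ F₁ : SignedMeasure X) : SignedMeasure X :=
  (1 - kappa F₀ F₁)⁻¹ • (F₀ - kappa F₀ F₁ • F₁)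

/-- `ν` is feasible in the maximization problem that defines `κ*(F₀ | F₁, …, F_K)`. -/
def Feasible {K : ℕ} (F₀ : SignedMeasure X) (F : Fin K → SignedMeasure X) (ν : Fin K → ℝ) : Prop :=
  (∀ i, 0 ≤ ν i) ∧ ∑ i, ν i ≤ 1 ∧
    ∃ G : ProbabilityMeasure X, F₀ = (1 - ∑ i, ν i) • distr G + ∑ i, ν i • F i

/-- `G` is a possible output of the search for a solution of `κ*(F₀ | F₁, …, F_K)`: some `ν`
maximizes `∑ᵢ νᵢ` among the feasible points, and `G = (F₀ - ∑ᵢ νᵢ Fᵢ) / (1 - ∑ᵢ νᵢ)`. -/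
def IsSolution {K : ℕ} (F₀ : SignedMeasure X) (F : Fin K → SignedMeasure X)
    (G : SignedMeasure X) : Prop :=
  ∃ ν : Fin K → ℝ, Feasible F₀ F ν ∧ (∀ ν', Feasible F₀ F ν' → ∑ i, ν' i ≤ ∑ i, ν i) ∧
    ∑ i, ν i ≠ 1 ∧ G = (1 - ∑ i, ν i)⁻¹ • (F₀ - ∑ i, ν i • F i)

/-- The face test returns `1`: `κ*(Qᵢ | Qⱼ) > 0` for all `i ≠ j`. -/
def FaceTest {K : ℕ} (Q : Fin K → SignedMeasure X) : Prop :=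
  ∀ i j, i ≠ j → 0 < kappa (Q i) (Q j)

/-! ### The random choices -/

/-- The solid simplex `{x ∈ ℝᵈ | xᵢ ≥ 0, ∑ᵢ xᵢ ≤ 1}`. -/
def solidSimplex (d : ℕ) : Set (Fin d → ℝ) :=
  {x | (∀ i, 0 ≤ x i) ∧ ∑ i, x i ≤ 1}

/-- The uniform distribution on the simplex of the weight vectors `(w₀, …, w_d)` with `wᵢ ≥ 0` and
`∑ᵢ wᵢ = 1`: the image of the normalized Lebesgue measure on the solid simplex in `ℝᵈ` under
the affine chart `x ↦ (1 - ∑ᵢ xᵢ, x)`. -/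
def uniformSimplex (d : ℕ) : Measure (Fin (d + 1) → ℝ) :=
  (ProbabilityTheory.cond volume (solidSimplex d)).map
    (fun x => Fin.cons (1 - ∑ i, x i) x)

/-- The random choices of a run on `K` distributions: for `K ≥ 3` a vector of `K - 1` weights,
followed by the random choices of the recursive call on `K - 1` distributions. -/
def Draws : ℕ → Type
  | 0 => Unit
  | 1 => Unit
  | 2 => Unit
  | m + 3 => (Fin (m + 2) → ℝ) × Draws (m + 2)

instance instMeasurableSpaceDraws : (K : ℕ) → MeasurableSpace (Draws K)
  | 0 => inferInstanceAs (MeasurableSpace Unit)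
  | 1 => inferInstanceAs (MeasurableSpace Unit)
  | 2 => inferInstanceAs (MeasurableSpace Unit)
  | m + 3 =>
    @Prod.instMeasurableSpace (Fin (m + 2) → ℝ) (Draws (m + 2)) _ (instMeasurableSpaceDraws (m + 2))

/-- The law of the random choices: the weight vectors of the different levels of the recursion are
independent, and each of them is uniform on its simplex. -/
def drawLaw : (K : ℕ) → Measure (Draws K)
  | 0 => Measure.dirac ()
  | 1 => Measure.dirac ()
  | 2 => Measure.dirac ()
  | m + 3 => (uniformSimplex (m + 1)).prod (drawLaw (m + 2))

theorem measurableSet_solidSimplex (d : ℕ) : MeasurableSet (solidSimplex d) := by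
  apply IsClosed.measurableSet
  have h : solidSimplex d = (⋂ i, {x : Fin d → ℝ | 0 ≤ x i}) ∩ {x | ∑ i, x i ≤ 1} := by
    ext x; simp [solidSimplex]
  rw [h]
  refine IsClosed.inter (isClosed_iInter fun i => ?_) ?_
  · exact isClosed_le continuous_const (continuous_apply i)
  · exact isClosed_le (by fun_prop) continuous_const

instance isProbabilityMeasure_uniformSimplex (d : ℕ) :
    IsProbabilityMeasure (uniformSimplex d) := by
  have h0 : volume (solidSimplex d) ≠ 0 := by
    have hsub : (Set.univ.pi fun _ : Fin d => Set.Icc (0 : ℝ) (1 / (d + 1))) ⊆ solidSimplex d := by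
      intro x hx
      simp only [Set.mem_pi, Set.mem_univ, true_implies, Set.mem_Icc] at hx
      refine ⟨fun i => (hx i).1, ?_⟩
      calc ∑ i, x i ≤ ∑ _i : Fin d, (1 / (d + 1) : ℝ) := Finset.sum_le_sum fun i _ => (hx i).2
        _ = d / (d + 1) := by simp [div_eq_mul_inv]
        _ ≤ 1 := by rw [div_le_one (by positivity)]; linarith
    refine ne_of_gt (lt_of_lt_of_le ?_ (measure_mono hsub))
    rw [volume_pi_pi, pos_iff_ne_zero, Finset.prod_ne_zero_iff]
    intro i _
    rw [Real.volume_Icc, ← pos_iff_ne_zero, ENNReal.ofReal_pos, sub_zero]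
    positivity
  have h1 : volume (solidSimplex d) ≠ ⊤ := by
    have hsub : solidSimplex d ⊆ Set.univ.pi fun _ : Fin d => Set.Icc (0 : ℝ) 1 := by
      intro x hx i _
      exact ⟨hx.1 i, (Finset.single_le_sum (fun j _ => hx.1 j) (Finset.mem_univ i)).trans hx.2⟩
    refine ne_of_lt (lt_of_le_of_lt (measure_mono hsub) ?_)
    rw [volume_pi_pi]
    simp
  have : IsProbabilityMeasure (ProbabilityTheory.cond volume (solidSimplex d)) :=
    ProbabilityTheory.cond_isProbabilityMeasure_of_finite h0 h1
  refine Measure.isProbabilityMeasure_map (Measurable.aemeasurable ?_)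
  refine measurable_pi_iff.2 fun i => ?_
  refine Fin.cases ?_ (fun j => ?_) i
  · simp only [Fin.cons_zero]; fun_prop
  · simp only [Fin.cons_succ]; fun_prop

instance isProbabilityMeasure_drawLaw : (K : ℕ) → IsProbabilityMeasure (drawLaw K)
  | 0 => inferInstanceAs (IsProbabilityMeasure (Measure.dirac ()))
  | 1 => inferInstanceAs (IsProbabilityMeasure (Measure.dirac ()))
  | 2 => inferInstanceAs (IsProbabilityMeasure (Measure.dirac ()))
  | m + 3 =>
    have := isProbabilityMeasure_drawLaw (m + 2)
    inferInstanceAs (IsProbabilityMeasure ((uniformSimplex (m + 1)).prod (drawLaw (m + 2))))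

/-! ### The algorithm

Inputs are numbered from `0`: the family `S 0, S 1, …, S (K - 1)` stands for `S₁, …, S_K`. -/

/-- The element `∑ᵢ wᵢ Sᵢ` of the convex hull of `S₂, …, S_K` with weights `w`. For affinely
independent `S₂, …, S_K` this is a bijection between the simplex of weights and the convex hull,
and it carries the uniform distribution to the uniform distribution. -/
def hullPoint {m : ℕ} (S : Fin (m + 3) → SignedMeasure X) (w : Fin (m + 2) → ℝ) :
    SignedMeasure X :=
  ∑ i, w i • S i.succ

/-- The mixtures `(1/n) Sᵢ + ((n-1)/n) Q`, `i = 2, …, K`. -/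
def loopMix {m : ℕ} (S : Fin (m + 3) → SignedMeasure X) (Q : SignedMeasure X) (n : ℕ) :
    Fin (m + 2) → SignedMeasure X :=
  fun i => (1 / (n : ℝ)) • S i.succ + (((n : ℝ) - 1) / (n : ℝ)) • Q

/-- The residues `Rᵢ` of these mixtures with respect to `S₁`. -/
def loopResidue {m : ℕ} (S : Fin (m + 3) → SignedMeasure X) (Q : SignedMeasure X) (n : ℕ) :
    Fin (m + 2) → SignedMeasure X :=
  fun i => residue (loopMix S Q n i) (S 0)

/-- The loop over `n = 2, 3, …` stops at `n`: the residues computed so far are well defined, and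
`n` is the first index at which the face test returns `1`. -/
def LoopStops {m : ℕ} (S : Fin (m + 3) → SignedMeasure X) (Q : SignedMeasure X) (n : ℕ) : Prop :=
  2 ≤ n ∧ (∀ k, 2 ≤ k → k ≤ n → ∀ i, loopMix S Q k i ≠ S 0) ∧
    FaceTest (loopResidue S Q n) ∧ ∀ k, 2 ≤ k → k < n → ¬ FaceTest (loopResidue S Q k)

/-- `DemixReturns K S ω Q`: run on the inputs `S` with the random choices `ω`, the algorithm
terminates and may return `Q`. It is a relation because the last step of a call may return any
solution. The algorithm is defined for `K ≥ 2`. -/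
def DemixReturns : (K : ℕ) → (Fin K → SignedMeasure X) → Draws K → (Fin K → SignedMeasure X) → Prop
  | 0, _, _, _ => False
  | 1, _, _, _ => False
  | 2, S, _, Q => S 0 ≠ S 1 ∧ Q = ![residue (S 0) (S 1), residue (S 1) (S 0)]
  | m + 3, S, ω, Q =>
    ∃ n : ℕ, LoopStops S (hullPoint S ω.1) n ∧
      ∃ Q' : Fin (m + 2) → SignedMeasure X,
        DemixReturns (m + 2) (loopResidue S (hullPoint S ω.1) n) ω.2 Q' ∧
        ∃ G : SignedMeasure X,
          IsSolution ((1 / ((m : ℝ) + 3)) • ∑ i, S i) Q' G ∧ Q = Fin.snoc Q' G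

end Demixing

end

/-!
By joint irreducibility, `γ ↦ ∑ᵢ γᵢ Pᵢ` is injective, and a point of its image is a probability
distribution exactly when `γ` lies in the standard simplex (`JointlyIrreducible.mem_stdSimplex`,
`JointlyIrreducible.mixture_injective`). Hence every quantity in the algorithm can be computed in
barycentric coordinates: `κ*(a | b)` is the smallest ratio `aⱼ / bⱼ` (`coordKappa`), it is positive
if and only if `a` is positive wherever `b` is, and the residue is the point where the ray from `b`
through `a` leaves the simplex.

The recursion preserves the following situation (`IsFrame`): the `K` inputs are linearly independent
points of a face with `K` vertices. If the face test succeeds, the residues all have the same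
support, which is smaller than the face because a residue lies on the boundary. As the residues are
again linearly independent, they form a frame of a facet
(`CoordLoopStops.exists_isFrame_erase`). By induction the recursive call returns the vertices of
this facet. The average of the inputs has positive weight at the missing vertex, so the only
solution in the last step is that vertex (`JointlyIrreducible.isSolution_iff`).

Randomness is needed only for the loop to stop. If the ray from `S₁` through `Q` leaves the face in
the relative interior of a facet, then so do the rays from `S₁` through nearby points of the face,
and the face test succeeds for large `n` (`Generic.exists_coordLoopStops`). The exceptional weights
lie in finitely many hyperplanes, none of which contains the whole simplex because the inputs span
the face (`IsFrame.ae_generic`). To combine the draws of the different levels by Fubini's theorem, the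
set of good draws is shown to be measurable jointly in the draws and the inputs
(`measurableSet_good`).
-/

open Filter Topology

noncomputable section

namespace Demixing

section Coordinates

/-! ### The two-sample operators in barycentric coordinates -/

variable {ι : Type*} [Fintype ι] {a b : ι → ℝ}

/-- The two-sample operator for points `a`, `b` of the standard simplex. The value `1` at the
coordinates where `b` vanishes does not influence the infimum, which is at most `1` anyway. -/
def coordKappa (a b : ι → ℝ) : ℝ :=
  ⨅ j, if 0 < b j then a j / b j else 1

/-- The residue of `a` with respect to `b`: for `a ≠ b` in the standard simplex, the point where
the ray from `b` through `a` leaves the simplex. -/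
def coordResidue (a b : ι → ℝ) : ι → ℝ :=
  (1 - coordKappa a b)⁻¹ • (a - coordKappa a b • b)

theorem nonempty_of_mem_stdSimplex (ha : a ∈ stdSimplex ℝ ι) : Nonempty ι := by
  by_contra h
  rw [not_nonempty_iff] at h
  simpa using ha.2

theorem coordKappa_mul_le (ha : a ∈ stdSimplex ℝ ι) (hb : b ∈ stdSimplex ℝ ι) (j : ι) :
    coordKappa a b * b j ≤ a j := by
  rcases (hb.1 j).eq_or_lt with h | h
  · simpa [← h] using ha.1 j
  · exact (le_div_iff₀ h).1 ((ciInf_le (Set.finite_range _).bddBelow j).trans_eq (if_pos h))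

theorem le_coordKappa (hb : b ∈ stdSimplex ℝ ι) {κ : ℝ} (hκ : κ ≤ 1)
    (h : ∀ j, κ * b j ≤ a j) : κ ≤ coordKappa a b := by
  have := nonempty_of_mem_stdSimplex hb
  refine le_ciInf fun j => ?_
  split_ifs with hj
  · exact (le_div_iff₀ hj).2 (h j)
  · exact hκ

theorem coordKappa_nonneg (ha : a ∈ stdSimplex ℝ ι) (hb : b ∈ stdSimplex ℝ ι) :
    0 ≤ coordKappa a b :=
  le_coordKappa hb zero_le_one fun j => by simpa using ha.1 j

theorem coordKappa_le_one (ha : a ∈ stdSimplex ℝ ι) (hb : b ∈ stdSimplex ℝ ι) :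
    coordKappa a b ≤ 1 := by
  have h := Finset.sum_le_sum fun j (_ : j ∈ Finset.univ) => coordKappa_mul_le ha hb j
  rwa [← Finset.mul_sum, ha.2, hb.2, mul_one] at h

theorem eq_of_le_of_mem_stdSimplex (ha : a ∈ stdSimplex ℝ ι) (hb : b ∈ stdSimplex ℝ ι)
    (h : ∀ j, b j ≤ a j) : a = b := by
  funext j
  exact ((Finset.sum_eq_sum_iff_of_le fun j _ => h j).1 (hb.2.trans ha.2.symm) j
    (Finset.mem_univ j)).symm

theorem coordKappa_lt_one (ha : a ∈ stdSimplex ℝ ι) (hb : b ∈ stdSimplex ℝ ι) (hab : a ≠ b) :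
    coordKappa a b < 1 := by
  refine (coordKappa_le_one ha hb).lt_of_ne fun h => hab ?_
  exact eq_of_le_of_mem_stdSimplex ha hb fun j => by simpa [h] using coordKappa_mul_le ha hb j

theorem exists_eq_coordKappa_mul (ha : a ∈ stdSimplex ℝ ι) (hb : b ∈ stdSimplex ℝ ι)
    (hab : a ≠ b) : ∃ j, 0 < b j ∧ a j = coordKappa a b * b j := by
  have := nonempty_of_mem_stdSimplex hb
  obtain ⟨j, hj⟩ := exists_eq_ciInf_of_finite (f := fun j => if 0 < b j then a j / b j else 1)
  change _ = coordKappa a b at hj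
  have hlt := coordKappa_lt_one ha hb hab
  by_cases h : 0 < b j
  · refine ⟨j, h, ?_⟩
    rw [← hj]
    simp only [h, if_true]
    field_simp
  · simp only [h, if_false] at hj
    exact absurd hj hlt.ne'

theorem coordKappa_pos_iff (ha : a ∈ stdSimplex ℝ ι) (hb : b ∈ stdSimplex ℝ ι) :
    0 < coordKappa a b ↔ ∀ j, 0 < b j → 0 < a j := by
  constructor
  · exact fun h j hj => (mul_pos h hj).trans_le (coordKappa_mul_le ha hb j)
  · intro h
    by_cases hab : a = b
    · refine zero_lt_one.trans_le (le_coordKappa hb le_rfl fun j => ?_)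
      rw [hab, one_mul]
    · obtain ⟨j, hj, hj'⟩ := exists_eq_coordKappa_mul ha hb hab
      exact pos_of_mul_pos_left (hj' ▸ h j hj) hj.le

theorem coordResidue_apply {ι : Type*} (a b : ι → ℝ) (j : ι) :
    coordResidue a b j = (1 - coordKappa a b)⁻¹ * (a j - coordKappa a b * b j) := rfl

theorem coordResidue_mem_stdSimplex (ha : a ∈ stdSimplex ℝ ι) (hb : b ∈ stdSimplex ℝ ι)
    (hab : a ≠ b) : coordResidue a b ∈ stdSimplex ℝ ι := by
  have h := sub_pos.2 (coordKappa_lt_one ha hb hab)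
  refine ⟨fun j => mul_nonneg (inv_nonneg.2 h.le) (sub_nonneg.2 (coordKappa_mul_le ha hb j)), ?_⟩
  simp only [coordResidue_apply]
  rw [← Finset.mul_sum, Finset.sum_sub_distrib, ← Finset.mul_sum, ha.2, hb.2, mul_one,
    inv_mul_cancel₀ h.ne']

theorem coordResidue_eq_zero {ι : Type*} {a b : ι → ℝ} {j : ι} (h : a j = coordKappa a b * b j) :
    coordResidue a b j = 0 := by
  rw [coordResidue_apply, sub_eq_zero.2 h, mul_zero]

theorem coordResidue_eq_zero_of_eq_zero {ι : Type*} {a b : ι → ℝ} {j : ι} (ha : a j = 0)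
    (hb : b j = 0) :
    coordResidue a b j = 0 :=
  coordResidue_eq_zero (by rw [ha, hb, mul_zero])

/-- If the ratio `aⱼ / bⱼ` is smallest at `j = k`, then the residue is positive exactly at the
coordinates where this ratio is not the smallest one (all ratios being cleared of denominators). -/
theorem coordResidue_pos_iff (ha : a ∈ stdSimplex ℝ ι) (hb : b ∈ stdSimplex ℝ ι)
    (hab : a ≠ b) {k : ι} (hk : 0 < b k) (h : ∀ j, a k * b j ≤ a j * b k) (j : ι) :
    0 < coordResidue a b j ↔ a k * b j < a j * b k := by
  have hle : a k ≤ b k := by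
    have := Finset.sum_le_sum fun j (_ : j ∈ Finset.univ) => h j
    rwa [← Finset.mul_sum, ← Finset.sum_mul, ha.2, hb.2, mul_one, one_mul] at this
  have hκ : coordKappa a b = a k / b k := by
    apply le_antisymm
    · exact (le_div_iff₀ hk).2 (coordKappa_mul_le ha hb k)
    · refine le_coordKappa hb ((div_le_one hk).2 hle) fun j => ?_
      rw [div_mul_eq_mul_div]
      exact (div_le_iff₀ hk).2 (h j)
  rw [coordResidue_apply,
    mul_pos_iff_of_pos_left (inv_pos.2 (sub_pos.2 (coordKappa_lt_one ha hb hab))), sub_pos, hκ,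
    div_mul_eq_mul_div, div_lt_iff₀ hk]

theorem measurable_coordKappa {α : Type*} [MeasurableSpace α] {f g : α → ι → ℝ}
    (hf : Measurable f) (hg : Measurable g) : Measurable fun x => coordKappa (f x) (g x) := by
  have hf' := fun j => (measurable_pi_apply j).comp hf
  have hg' := fun j => (measurable_pi_apply j).comp hg
  refine Measurable.iInf fun j => ?_
  exact Measurable.ite (measurableSet_lt measurable_const (hg' j)) ((hf' j).div (hg' j))
    measurable_const

theorem measurable_coordResidue {α : Type*} [MeasurableSpace α] {f g : α → ι → ℝ}
    (hf : Measurable f) (hg : Measurable g) : Measurable fun x => coordResidue (f x) (g x) := by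
  have h := measurable_coordKappa hf hg
  exact (measurable_const.sub h).inv.smul (hf.sub (h.smul hg))

/-! ### Families that span a face of the simplex -/

/-- The points `S₁, …, S_K` of the standard simplex are linearly independent and lie in the face
with vertex set `F`, which has as many vertices as there are points. -/
structure IsFrame {K : ℕ} (F : Finset ι) (S : Fin K → ι → ℝ) : Prop where
  mem_stdSimplex : ∀ i, S i ∈ stdSimplex ℝ ι
  eq_zero : ∀ i, ∀ j ∉ F, S i j = 0
  linearIndependent : LinearIndependent ℝ S
  card_eq : F.card = K

/-- A linear form that vanishes on a frame vanishes on the vertices of the face. -/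
theorem IsFrame.map_single_eq_zero [DecidableEq ι] {K : ℕ} {F : Finset ι} {S : Fin K → ι → ℝ}
    (hS : IsFrame F S) (f : (ι → ℝ) →ₗ[ℝ] ℝ) (hf : ∀ i, f (S i) = 0) {j : ι} (hj : j ∈ F) :
    f (Pi.single j 1) = 0 := by
  set T : Finset (ι → ℝ) := F.image fun j => Pi.single j 1 with hT
  have hle : Submodule.span ℝ (Set.range S) ≤ Submodule.span ℝ (T : Set (ι → ℝ)) := by
    rw [Submodule.span_le]
    rintro _ ⟨i, rfl⟩
    have : S i = ∑ j ∈ F, S i j • Pi.single j (1 : ℝ) := by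
      funext l
      simp only [Finset.sum_apply, Pi.smul_apply, Pi.single_apply, smul_eq_mul, mul_ite, mul_one,
        mul_zero, Finset.sum_ite_eq]
      split_ifs with hl
      · rfl
      · exact hS.eq_zero i l hl
    rw [SetLike.mem_coe, this]
    refine Submodule.sum_mem _ fun j hj => Submodule.smul_mem _ _ (Submodule.subset_span ?_)
    exact Finset.mem_coe.2 (Finset.mem_image_of_mem _ hj)
  have heq := Submodule.eq_of_le_of_finrank_le hle (by
    rw [finrank_span_eq_card hS.linearIndependent, Fintype.card_fin]
    exact (finrank_span_finset_le_card T).trans (Finset.card_image_le.trans hS.card_eq.le))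
  have hmem : (Pi.single j 1 : ι → ℝ) ∈ Submodule.span ℝ (Set.range S) := by
    rw [heq]
    exact Submodule.subset_span (Finset.mem_coe.2 (Finset.mem_image_of_mem _ hj))
  have hker : Submodule.span ℝ (Set.range S) ≤ LinearMap.ker f := by
    rw [Submodule.span_le]
    rintro _ ⟨i, rfl⟩
    exact hf i
  exact hker hmem

theorem IsFrame.exists_pos {K : ℕ} {F : Finset ι} {S : Fin K → ι → ℝ}
    (hS : IsFrame F S) {j : ι} (hj : j ∈ F) : ∃ i, 0 < S i j := by
  classical
  by_contra! h
  have := hS.map_single_eq_zero (LinearMap.proj j)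
    (fun i => le_antisymm (h i) ((hS.mem_stdSimplex i).1 j)) hj
  simp at this

theorem IsFrame.exists_cross_ne_zero {m : ℕ} {F : Finset ι} {S : Fin (m + 3) → ι → ℝ}
    (hS : IsFrame F S) {j k : ι} (hj : j ∈ F) (hjk : j ≠ k) (hk : 0 < S 0 k) :
    ∃ i : Fin (m + 2), S i.succ j * S 0 k - S i.succ k * S 0 j ≠ 0 := by
  classical
  by_contra! h
  have := hS.map_single_eq_zero
    (S 0 k • LinearMap.proj (R := ℝ) (φ := fun _ : ι => ℝ) j - S 0 j • LinearMap.proj k) (fun i => by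
      refine Fin.cases ?_ (fun i => ?_) i
      · simp [mul_comm (S 0 j)]
      · simpa [mul_comm] using h i) hj
  simp [hjk.symm, hk.ne'] at this

/-! ### The loop in barycentric coordinates -/

/-- The mixtures formed in the loop, for inputs in the standard simplex and weights `w`. -/
def coordLoopMix {m : ℕ} (S : Fin (m + 3) → ι → ℝ) (w : Fin (m + 2) → ℝ) (n : ℕ) :
    Fin (m + 2) → ι → ℝ :=
  fun i => (1 / (n : ℝ)) • S i.succ + (((n : ℝ) - 1) / (n : ℝ)) • ∑ l, w l • S l.succ

/-- The residues of these mixtures with respect to the first input. -/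
def coordLoopResidue {m : ℕ} (S : Fin (m + 3) → ι → ℝ) (w : Fin (m + 2) → ℝ) (n : ℕ) :
    Fin (m + 2) → ι → ℝ :=
  fun i => coordResidue (coordLoopMix S w n i) (S 0)

/-- The face test in coordinates. -/
def CoordFaceTest {K : ℕ} (R : Fin K → ι → ℝ) : Prop :=
  ∀ i j, i ≠ j → 0 < coordKappa (R i) (R j)

/-- The loop with inputs `S` and weights `w` stops at `n`. -/
def CoordLoopStops {m : ℕ} (S : Fin (m + 3) → ι → ℝ) (w : Fin (m + 2) → ℝ) (n : ℕ) : Prop :=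
  2 ≤ n ∧ CoordFaceTest (coordLoopResidue S w n) ∧
    ∀ k, 2 ≤ k → k < n → ¬ CoordFaceTest (coordLoopResidue S w k)

section Loop

variable {m : ℕ} {F : Finset ι} {S : Fin (m + 3) → ι → ℝ} {w : Fin (m + 2) → ℝ} {n : ℕ}

theorem sum_smul_mem_stdSimplex {κ : Type*} [Fintype κ] {S : κ → ι → ℝ} {w : κ → ℝ}
    (hS : ∀ i, S i ∈ stdSimplex ℝ ι) (hw : w ∈ stdSimplex ℝ κ) :
    ∑ l, w l • S l ∈ stdSimplex ℝ ι :=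
  (convex_stdSimplex ℝ ι).sum_mem (fun l _ => hw.1 l) hw.2 fun l _ => hS l

theorem coordLoopMix_mem_stdSimplex (hS : ∀ i, S i ∈ stdSimplex ℝ ι)
    (hw : w ∈ stdSimplex ℝ (Fin (m + 2))) (hn : 2 ≤ n) (i : Fin (m + 2)) :
    coordLoopMix S w n i ∈ stdSimplex ℝ ι := by
  have hn' : (2 : ℝ) ≤ n := by exact_mod_cast hn
  refine convex_stdSimplex ℝ ι (hS i.succ) (sum_smul_mem_stdSimplex (fun l => hS l.succ) hw)
    (a := 1 / (n : ℝ)) (b := ((n : ℝ) - 1) / n) (by positivity)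
    (div_nonneg (by linarith) (by linarith)) ?_
  field_simp
  ring

theorem coordLoopMix_eq_zero {ι : Type*} {S : Fin (m + 3) → ι → ℝ} {j : ι}
    (h : ∀ i, S i j = 0) (i : Fin (m + 2)) :
    coordLoopMix S w n i j = 0 := by
  simp [coordLoopMix, h]

theorem coordLoopMix_ne {ι : Type*} {S : Fin (m + 3) → ι → ℝ} (hS : LinearIndependent ℝ S)
    (i : Fin (m + 2)) : coordLoopMix S w n i ≠ S 0 := by
  classical
  intro h
  have := Fintype.linearIndependent_iff.1 hS
    (Fin.cons (-1) fun l => (1 / (n : ℝ)) * (if l = i then 1 else 0) +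
      (((n : ℝ) - 1) / n) * w l) (by
      rw [Fin.sum_univ_succ]
      simp only [Fin.cons_zero, Fin.cons_succ, add_smul, mul_smul, Finset.sum_add_distrib,
        ← Finset.smul_sum, ite_smul, one_smul, zero_smul, Finset.sum_ite_eq', Finset.mem_univ,
        if_true]
      rw [← h, neg_one_smul]
      exact neg_add_cancel _) 0
  simp at this

theorem linearIndependent_coordLoopResidue (hS : IsFrame F S)
    (hw : w ∈ stdSimplex ℝ (Fin (m + 2))) (hn : 2 ≤ n) :
    LinearIndependent ℝ (coordLoopResidue S w n) := by
  have hn' : (2 : ℝ) ≤ n := by exact_mod_cast hn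
  have hn0 : (n : ℝ) ≠ 0 := by positivity
  rw [Fintype.linearIndependent_iff]
  intro c hc
  set κ : Fin (m + 2) → ℝ := fun i => coordKappa (coordLoopMix S w n i) (S 0) with hκ
  have hpos : ∀ i, 0 < 1 - κ i := fun i => sub_pos.2 (coordKappa_lt_one
    (coordLoopMix_mem_stdSimplex hS.mem_stdSimplex hw hn i) (hS.mem_stdSimplex 0)
    (coordLoopMix_ne hS.linearIndependent i))
  set d : Fin (m + 2) → ℝ := fun i => c i * (1 - κ i)⁻¹ with hd
  -- The coefficients of the relation `∑ᵢ cᵢ Rᵢ = 0` when it is written in terms of the inputs.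
  have hrel := Fintype.linearIndependent_iff.1 hS.linearIndependent
    (Fin.cons (-∑ i, d i * κ i) fun l => (1 / (n : ℝ)) * d l +
      (((n : ℝ) - 1) / n * ∑ i, d i) * w l) (by
      rw [← hc, Fin.sum_univ_succ]
      simp only [Fin.cons_zero, Fin.cons_succ, add_smul, Finset.sum_add_distrib, mul_smul,
        ← Finset.smul_sum]
      have : ∀ i, c i • coordLoopResidue S w n i = (1 / (n : ℝ)) • (d i • S i.succ) +
          (((n : ℝ) - 1) / n) • (d i • ∑ l, w l • S l.succ) - (d i * κ i) • S 0 := by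
        intro i
        funext j
        change c i * ((1 - κ i)⁻¹ * ((1 / (n : ℝ)) * S i.succ j +
            (((n : ℝ) - 1) / n) * (∑ l, w l • S l.succ) j - κ i * S 0 j)) =
          (1 / (n : ℝ)) * (c i * (1 - κ i)⁻¹ * S i.succ j) +
            (((n : ℝ) - 1) / n) * (c i * (1 - κ i)⁻¹ * (∑ l, w l • S l.succ) j) -
            c i * (1 - κ i)⁻¹ * κ i * S 0 j
        ring
      simp only [this, Finset.sum_sub_distrib, Finset.sum_add_distrib, ← Finset.smul_sum,
        ← Finset.sum_smul, neg_smul]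
      abel)
  have hl : ∀ l, (1 / (n : ℝ)) * d l + (((n : ℝ) - 1) / n * ∑ i, d i) * w l = 0 :=
    fun l => by simpa using hrel l.succ
  have hsum : ∑ i, d i = 0 := by
    have h := Finset.sum_congr (rfl : Finset.univ = Finset.univ) fun l _ => hl l
    rw [Finset.sum_add_distrib, ← Finset.mul_sum, ← Finset.mul_sum, hw.2] at h
    simp only [Finset.sum_const_zero] at h
    rw [mul_one, ← add_mul, ← add_div, add_sub_cancel, div_self hn0, one_mul] at h
    exact h
  intro i
  have h := hl i
  rw [hsum] at h
  have hdi : d i = 0 := by simpa [hn0] using h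
  exact (mul_eq_zero.1 hdi).resolve_right (inv_ne_zero (hpos i).ne')

/-- When the face test succeeds, all residues have the same support; it misses a coordinate at which
the first of the residues vanishes, so the residues span a facet. -/
theorem CoordLoopStops.exists_isFrame_erase [DecidableEq ι] (hS : IsFrame F S)
    (hw : w ∈ stdSimplex ℝ (Fin (m + 2))) (h : CoordLoopStops S w n) :
    ∃ k ∈ F, IsFrame (F.erase k) (coordLoopResidue S w n) := by
  have hT := coordLoopMix_mem_stdSimplex hS.mem_stdSimplex hw h.1
  have hne := coordLoopMix_ne (w := w) (n := n) hS.linearIndependent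
  have hR : ∀ i, coordLoopResidue S w n i ∈ stdSimplex ℝ ι := fun i =>
    coordResidue_mem_stdSimplex (hT i) (hS.mem_stdSimplex 0) (hne i)
  obtain ⟨k, hk, hk'⟩ := exists_eq_coordKappa_mul (hT 0) (hS.mem_stdSimplex 0) (hne 0)
  have hkF : k ∈ F := by
    by_contra hkF
    exact hk.ne' (hS.eq_zero 0 k hkF)
  have h0 : coordLoopResidue S w n 0 k = 0 := coordResidue_eq_zero hk'
  refine ⟨k, hkF, hR, fun i j hj => ?_, linearIndependent_coordLoopResidue hS hw h.1, ?_⟩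
  · by_cases hjk : j = k
    · subst hjk
      by_cases hi : i = 0
      · rw [hi, h0]
      · have := (coordKappa_pos_iff (hR 0) (hR i)).1 (h.2.1 0 i (Ne.symm hi)) j
        rw [h0] at this
        exact le_antisymm (not_lt.1 fun h => lt_irrefl _ (this h)) ((hR i).1 j)
    · have hjF : j ∉ F := fun hjF => hj (Finset.mem_erase.2 ⟨hjk, hjF⟩)
      exact coordResidue_eq_zero_of_eq_zero (coordLoopMix_eq_zero (fun i => hS.eq_zero i j hjF) i)
        (hS.eq_zero 0 j hjF)
  · rw [Finset.card_erase_of_mem hkF, hS.card_eq]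
    rfl

theorem CoordLoopStops.unique {ι : Type*} {S : Fin (m + 3) → ι → ℝ} {n' : ℕ}
    (h : CoordLoopStops S w n) (h' : CoordLoopStops S w n') : n = n' := by
  rcases lt_trichotomy n n' with hlt | heq | hlt
  · exact absurd h.2.1 (h'.2.2 n h.1 hlt)
  · exact heq
  · exact absurd h'.2.1 (h.2.2 n' h'.1 hlt)

/-- Weights `w` are generic for `S` if the point `Q = ∑ᵢ wᵢ Sᵢ` satisfies `Qⱼ / S₁ⱼ ≠ Qₖ / S₁ₖ` for
all vertices `j ≠ k` of the face (cleared of denominators). Then the ray from `S₁` through `Q`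
leaves the face in the relative interior of a facet. -/
def Generic (F : Finset ι) (S : Fin (m + 3) → ι → ℝ) (w : Fin (m + 2) → ℝ) : Prop :=
  ∀ j ∈ F, ∀ k ∈ F, j ≠ k → 0 < S 0 k →
    ∑ l, w l * (S l.succ j * S 0 k - S l.succ k * S 0 j) ≠ 0

theorem Generic.exists_coordLoopStops (hS : IsFrame F S)
    (hw : w ∈ stdSimplex ℝ (Fin (m + 2))) (h : Generic F S w) :
    ∃ n, CoordLoopStops S w n := by
  classical
  suffices h : ∃ n, 2 ≤ n ∧ CoordFaceTest (coordLoopResidue S w n) by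
    refine ⟨Nat.find h, (Nat.find_spec h).1, (Nat.find_spec h).2, fun k hk hlt hf => ?_⟩
    exact Nat.find_min h hlt ⟨hk, hf⟩
  set b := S 0 with hb
  set Q : ι → ℝ := ∑ l, w l • S l.succ with hQ
  have hbmem : b ∈ stdSimplex ℝ ι := hS.mem_stdSimplex 0
  have hQmem : Q ∈ stdSimplex ℝ ι :=
    sum_smul_mem_stdSimplex (fun l => hS.mem_stdSimplex l.succ) hw
  have hcross : ∀ j ∈ F, ∀ k ∈ F, j ≠ k → 0 < b k → Q k * b j ≠ Q j * b k := by
    intro j hj k hk hjk hbk heq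
    refine h j hj k hk hjk hbk ?_
    simp only [hQ, Finset.sum_apply, Pi.smul_apply, smul_eq_mul, Finset.sum_mul] at heq
    simp only [mul_sub, Finset.sum_sub_distrib, ← mul_assoc]
    exact sub_eq_zero.2 heq.symm
  -- The coordinate `k` minimizes `Qₖ / bₖ`; by genericity it is the only one.
  have hQb : Q ≠ b := by
    intro heq
    obtain ⟨k, hk⟩ : ∃ k, 0 < b k := by
      by_contra! hle
      have := Finset.sum_nonpos fun k (_ : k ∈ Finset.univ) => hle k
      linarith [hbmem.2]
    have hkF : k ∈ F := by
      by_contra hkF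
      exact hk.ne' (hS.eq_zero 0 k hkF)
    obtain ⟨j, hj, hjk⟩ : ∃ j ∈ F, j ≠ k :=
      Finset.exists_mem_ne (by have := hS.card_eq; omega) k
    exact hcross j hj k hkF hjk hk (by rw [heq, mul_comm])
  obtain ⟨k, hk, hmin⟩ := exists_eq_coordKappa_mul hQmem hbmem hQb
  have hkF : k ∈ F := by
    by_contra hkF
    exact hk.ne' (hS.eq_zero 0 k hkF)
  have hlt : ∀ j ∈ F, j ≠ k → Q k * b j < Q j * b k := by
    intro j hj hjk
    refine lt_of_le_of_ne ?_ (hcross j hj k hkF hjk hk)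
    have := mul_le_mul_of_nonneg_right (coordKappa_mul_le hQmem hbmem j) hk.le
    rw [hmin]
    linarith
  -- The mixtures converge to `Q`, so `k` is the strict minimizer for them, too.
  have hlim : ∀ i j, Tendsto (fun n : ℕ => coordLoopMix S w n i j) atTop (𝓝 (Q j)) := by
    intro i j
    have h1 : Tendsto (fun n : ℕ => 1 / (n : ℝ)) atTop (𝓝 0) := tendsto_one_div_atTop_nhds_zero_nat
    have h2 := (h1.mul_const (S i.succ j)).add ((h1.const_sub 1).mul_const (Q j))
    simp only [zero_mul, sub_zero, one_mul, zero_add] at h2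
    refine h2.congr' ?_
    filter_upwards [eventually_ge_atTop 1] with n hn
    have hn0 : (n : ℝ) ≠ 0 := by positivity
    change _ = 1 / (n : ℝ) * S i.succ j + ((n : ℝ) - 1) / n * Q j
    rw [sub_div, div_self hn0]
  have hev : ∀ᶠ n : ℕ in atTop, ∀ i, ∀ j, j ∈ F → j ≠ k →
      coordLoopMix S w n i k * b j < coordLoopMix S w n i j * b k := by
    simp only [eventually_all]
    intro i j hj hjk
    exact ((hlim i k).mul_const _).eventually_lt ((hlim i j).mul_const _) (hlt j hj hjk)
  obtain ⟨n, hn, hn2⟩ := (hev.and (eventually_ge_atTop 2)).exists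
  have hT := coordLoopMix_mem_stdSimplex hS.mem_stdSimplex hw hn2
  have hne := coordLoopMix_ne (w := w) (n := n) hS.linearIndependent
  have hR : ∀ i, coordLoopResidue S w n i ∈ stdSimplex ℝ ι := fun i =>
    coordResidue_mem_stdSimplex (hT i) hbmem (hne i)
  have hpos : ∀ i j, 0 < coordLoopResidue S w n i j ↔ j ∈ F ∧ j ≠ k := by
    intro i j
    have hzero : ∀ j ∉ F, coordLoopMix S w n i j = 0 ∧ b j = 0 := fun j hj =>
      ⟨coordLoopMix_eq_zero (fun i => hS.eq_zero i j hj) i, hS.eq_zero 0 j hj⟩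
    refine (coordResidue_pos_iff (hT i) hbmem (hne i) hk (fun j => ?_) j).trans ⟨fun hj => ?_, ?_⟩
    · by_cases hjF : j ∈ F
      · by_cases hjk : j = k
        · rw [hjk]
        · exact (hn i j hjF hjk).le
      · rw [(hzero j hjF).1, (hzero j hjF).2, mul_zero, zero_mul]
    · refine ⟨?_, fun hjk => lt_irrefl _ (hjk ▸ hj)⟩
      by_contra hjF
      rw [(hzero j hjF).1, (hzero j hjF).2, mul_zero, zero_mul] at hj
      exact lt_irrefl _ hj
    · exact fun hj => hn i j hj.1 hj.2
  exact ⟨n, hn2, fun i i' _ => (coordKappa_pos_iff (hR i) (hR i')).2 fun j hj =>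
    (hpos i j).2 ((hpos i' j).1 hj)⟩

end Loop

end Coordinates

/-! ### Almost sure termination -/

theorem measurable_simplexChart (d : ℕ) :
    Measurable fun x : Fin d → ℝ => (Fin.cons (1 - ∑ i, x i) x : Fin (d + 1) → ℝ) := by
  refine measurable_pi_iff.2 fun i => ?_
  refine Fin.cases ?_ (fun j => ?_) i
  · simp only [Fin.cons_zero]; fun_prop
  · simp only [Fin.cons_succ]; fun_prop

theorem measurableSet_stdSimplex (ι : Type*) [Fintype ι] : MeasurableSet (stdSimplex ℝ ι) :=
  (isClosed_stdSimplex ℝ ι).measurableSet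

theorem ae_mem_stdSimplex (d : ℕ) :
    ∀ᵐ w ∂uniformSimplex d, w ∈ stdSimplex ℝ (Fin (d + 1)) := by
  refine (ae_map_iff (measurable_simplexChart d).aemeasurable (measurableSet_stdSimplex _)).2 ?_
  filter_upwards [ProbabilityTheory.ae_cond_mem (measurableSet_solidSimplex d)] with x hx
  refine ⟨fun i => ?_, ?_⟩
  · refine Fin.cases ?_ (fun j => ?_) i
    · simpa using hx.2
    · simpa using hx.1 j
  · simp [Fin.sum_univ_succ]

/-- In the chart of the simplex, a nonzero linear form in the weights becomes an affine form that is
not identically zero, since it does not vanish at all vertices. -/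
theorem ae_sum_mul_ne_zero {d : ℕ} (c : Fin (d + 1) → ℝ) (hc : ∃ i, c i ≠ 0) :
    ∀ᵐ w ∂uniformSimplex d, ∑ l, w l * c l ≠ 0 := by
  have hmeas : MeasurableSet {w : Fin (d + 1) → ℝ | ∑ l, w l * c l ≠ 0} :=
    (measurableSet_singleton (0 : ℝ)).compl.preimage (by fun_prop :
      Measurable fun w : Fin (d + 1) → ℝ => ∑ l, w l * c l)
  refine (ae_map_iff (measurable_simplexChart d).aemeasurable hmeas).2 ?_
  refine ProbabilityTheory.cond_absolutelyContinuous.ae_le ?_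
  let g : (Fin d → ℝ) →ₗ[ℝ] ℝ := ∑ i, (c i.succ - c 0) • LinearMap.proj i
  let A : AffineSubspace ℝ (Fin d → ℝ) :=
    { carrier := {x | c 0 + g x = 0}
      smul_vsub_vadd_mem' := by
        intro t x y z hx hy hz
        simp only [Set.mem_ofPred_eq, vsub_eq_sub, vadd_eq_add, map_add, map_smul, map_sub,
          smul_eq_mul] at hx hy hz ⊢
        linear_combination t * hx - t * hy + hz }
  have hA : A ≠ ⊤ := by
    intro htop
    have hall : ∀ x, c 0 + g x = 0 := fun x => by
      have : x ∈ A := htop ▸ AffineSubspace.mem_top ℝ _ x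
      exact this
    have h0 : c 0 = 0 := by simpa using hall 0
    obtain ⟨i, hi⟩ := hc
    refine hi (Fin.cases h0 (fun j => ?_) i)
    have hj := hall (Pi.single j 1)
    simpa [g, h0, Pi.single_apply] using hj
  filter_upwards [measure_eq_zero_iff_ae_notMem.1 (Measure.addHaar_affineSubspace volume A hA)]
    with x hx h
  refine hx ?_
  change c 0 + g x = 0
  rw [← h, Fin.sum_univ_succ]
  simp only [g, Fin.cons_zero, Fin.cons_succ, LinearMap.sum_apply, LinearMap.smul_apply,
    LinearMap.proj_apply, smul_eq_mul, sub_mul, Finset.sum_sub_distrib, ← Finset.mul_sum,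
    mul_comm (x _)]
  ring

section Termination

variable {ι : Type*} [Fintype ι]

theorem IsFrame.ae_generic {m : ℕ} {F : Finset ι} {S : Fin (m + 3) → ι → ℝ}
    (hS : IsFrame F S) : ∀ᵐ w ∂uniformSimplex (m + 1), Generic F S w := by
  simp only [Generic, eventually_all_finset, eventually_all]
  intro j hj k _ hjk hpos
  exact ae_sum_mul_ne_zero _ (hS.exists_cross_ne_zero hj hjk hpos)

/-- The random choices `ω` are good for the inputs `S` in the standard simplex: the weights drawn
are in the simplex and all loops of the run terminate. -/
def Good : (K : ℕ) → (Fin K → ι → ℝ) → Draws K → Prop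
  | 0, _, _ => True
  | 1, _, _ => True
  | 2, _, _ => True
  | m + 3, S, ω => ω.1 ∈ stdSimplex ℝ (Fin (m + 2)) ∧
      ∃ n, CoordLoopStops S ω.1 n ∧ Good (m + 2) (coordLoopResidue S ω.1 n) ω.2

theorem measurable_coordLoopResidue {m : ℕ} (n : ℕ) :
    Measurable fun p : (Fin (m + 3) → ι → ℝ) × (Fin (m + 2) → ℝ) =>
      coordLoopResidue p.1 p.2 n := by
  refine measurable_pi_iff.2 fun i => measurable_coordResidue ?_ (by fun_prop)
  unfold coordLoopMix
  fun_prop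

theorem measurableSet_coordFaceTest {K : ℕ} :
    MeasurableSet {R : Fin K → ι → ℝ | CoordFaceTest R} := by
  simp only [CoordFaceTest, Set.ofPred_forall]
  refine .iInter fun i => .iInter fun j => .iInter fun _ => ?_
  exact measurableSet_lt measurable_const
    (measurable_coordKappa (measurable_pi_apply i) (measurable_pi_apply j))

theorem measurableSet_coordLoopStops {m : ℕ} (n : ℕ) :
    MeasurableSet {p : (Fin (m + 3) → ι → ℝ) × (Fin (m + 2) → ℝ) |
      CoordLoopStops p.1 p.2 n} := by
  have h := fun k => (measurable_coordLoopResidue (ι := ι) (m := m) k)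
    measurableSet_coordFaceTest
  refine (MeasurableSet.const _).inter ((h n).inter (measurableSet_setOfPred.2 ?_))
  exact .forall fun k => .forall fun _ => .forall fun _ => (measurableSet_setOfPred.1 (h k)).not

theorem measurableSet_good : ∀ K : ℕ,
    MeasurableSet {p : (Fin K → ι → ℝ) × Draws K | Good K p.1 p.2}
  | 0 => .univ
  | 1 => .univ
  | 2 => .univ
  | m + 3 => by
    have hfst : Measurable fun p : (Fin (m + 3) → ι → ℝ) × Draws (m + 3) => (p.1, p.2.1) :=
      measurable_fst.prodMk (Measurable.comp
        (measurable_fst (α := Fin (m + 2) → ℝ) (β := Draws (m + 2))) measurable_snd)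
    have hsnd : Measurable fun p : (Fin (m + 3) → ι → ℝ) × Draws (m + 3) => p.2.2 :=
      Measurable.comp (measurable_snd (α := Fin (m + 2) → ℝ) (β := Draws (m + 2)))
        measurable_snd
    refine (hfst.snd (measurableSet_stdSimplex _)).inter (measurableSet_setOfPred.2 ?_)
    refine .exists fun n => measurableSet_setOfPred.1 ?_
    exact (hfst (measurableSet_coordLoopStops n)).inter
      ((((measurable_coordLoopResidue n).comp hfst).prodMk hsnd) (measurableSet_good (m + 2)))

/-- The random choices are almost surely good. Fubini's theorem reduces the claim to a single draw:
for generic weights the loop stops, at residues which are again a frame. -/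
theorem IsFrame.ae_good : ∀ {K : ℕ} {F : Finset ι} {S : Fin K → ι → ℝ}, IsFrame F S →
    ∀ᵐ ω ∂drawLaw K, Good K S ω
  | 0, _, _, _ => .of_forall fun _ => trivial
  | 1, _, _, _ => .of_forall fun _ => trivial
  | 2, _, _, _ => .of_forall fun _ => trivial
  | m + 3, F, S, hS => by
    classical
    have hmeas : MeasurableSet {ω : Draws (m + 3) | Good (m + 3) S ω} :=
      (measurable_prodMk_left (x := S)) (measurableSet_good (m + 3))
    refine (Measure.ae_prod_iff_ae_ae (μ := uniformSimplex (m + 1)) (ν := drawLaw (m + 2))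
      (p := fun ω => Good (m + 3) S ω) hmeas).2 ?_
    filter_upwards [ae_mem_stdSimplex (m + 1), hS.ae_generic] with w hw hgen
    obtain ⟨n, hn⟩ := hgen.exists_coordLoopStops hS hw
    obtain ⟨k, _, hk⟩ := hn.exists_isFrame_erase hS hw
    filter_upwards [hk.ae_good] with ω hω
    exact ⟨hw, n, hn, hω⟩

end Termination

/-! ### Mixtures of jointly irreducible distributions -/

section Mixtures

variable {X : Type*} [MeasurableSpace X] {L : ℕ} {P : Fin L → ProbabilityMeasure X}

/-- The linear map `γ ↦ ∑ᵢ γᵢ Pᵢ`. -/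
def mixture (P : Fin L → ProbabilityMeasure X) : (Fin L → ℝ) →ₗ[ℝ] SignedMeasure X :=
  Fintype.linearCombination ℝ fun i => distr (P i)

theorem mixture_apply (P : Fin L → ProbabilityMeasure X) (γ : Fin L → ℝ) :
    mixture P γ = ∑ i, γ i • distr (P i) := rfl

@[simp]
theorem mixture_single (P : Fin L → ProbabilityMeasure X) (j : Fin L) :
    mixture P (Pi.single j 1) = distr (P j) := by
  simp [mixture_apply, Pi.single_apply]

theorem distr_apply (H : ProbabilityMeasure X) {s : Set X} (hs : MeasurableSet s) :
    distr H s = (H : Measure X).real s :=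
  Measure.toSignedMeasure_apply_measurable hs

theorem mixture_apply_apply (γ : Fin L → ℝ) {s : Set X} (hs : MeasurableSet s) :
    mixture P γ s = ∑ i, γ i * (P i : Measure X).real s := by
  simp [mixture_apply, distr_apply _ hs]

theorem exists_mixture_eq_distr {γ : Fin L → ℝ} (hγ : γ ∈ stdSimplex ℝ (Fin L)) :
    ∃ H : ProbabilityMeasure X, mixture P γ = distr H := by
  let μ : Measure X := ∑ i, ENNReal.ofReal (γ i) • (P i : Measure X)
  have hμ : IsProbabilityMeasure μ := by
    constructor
    simp only [μ, Measure.coe_finsetSum, Finset.sum_apply, Measure.smul_apply, measure_univ,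
      smul_eq_mul, mul_one]
    rw [← ENNReal.ofReal_sum_of_nonneg fun i _ => hγ.1 i, hγ.2, ENNReal.ofReal_one]
  refine ⟨⟨μ, hμ⟩, VectorMeasure.ext fun s hs => ?_⟩
  refine (mixture_apply_apply _ hs).trans (Eq.trans ?_ (distr_apply _ hs).symm)
  change _ = (μ s).toReal
  simp only [μ, Measure.coe_finsetSum, Finset.sum_apply, Measure.smul_apply, smul_eq_mul]
  rw [ENNReal.toReal_sum fun i _ => ENNReal.mul_ne_top ENNReal.ofReal_ne_top (measure_ne_top _ _)]
  refine Finset.sum_congr rfl fun i _ => ?_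
  rw [ENNReal.toReal_mul, ENNReal.toReal_ofReal (hγ.1 i)]
  rfl

theorem JointlyIrreducible.mem_stdSimplex (hP : JointlyIrreducible P) {γ : Fin L → ℝ}
    {H : ProbabilityMeasure X} (h : mixture P γ = distr H) : γ ∈ stdSimplex ℝ (Fin L) := by
  refine ⟨hP γ ⟨H, h⟩, ?_⟩
  have := congrArg (fun μ : SignedMeasure X => μ Set.univ) h
  simpa [mixture_apply_apply _ MeasurableSet.univ, distr_apply _ MeasurableSet.univ] using this

/-- Jointly irreducible distributions are linearly independent: a nontrivial relation could be added
to `P_j` with a large factor of either sign, without changing that distribution. -/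
theorem JointlyIrreducible.mixture_injective (hP : JointlyIrreducible P) :
    Function.Injective (mixture P) := by
  have key : ∀ c, mixture P c = 0 → ∀ j, 0 ≤ c j := by
    intro c hc j
    by_contra! hneg
    have hmem : Pi.single j 1 + (-2 / c j) • c ∈ stdSimplex ℝ (Fin L) :=
      hP.mem_stdSimplex (H := P j) (by simp [hc])
    have := hmem.1 j
    simp only [Pi.add_apply, Pi.single_eq_same, Pi.smul_apply, smul_eq_mul,
      div_mul_cancel₀ _ hneg.ne] at this
    linarith
  rw [injective_iff_map_eq_zero]
  intro c hc
  funext j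
  refine le_antisymm ?_ (key c hc j)
  simpa using key (-c) (by rw [map_neg, hc, neg_zero]) j

theorem JointlyIrreducible.exists_eq_smul_add_iff (hP : JointlyIrreducible P) (a c : Fin L → ℝ)
    {s : ℝ} (hs : s < 1) :
    (∃ G : ProbabilityMeasure X, mixture P a = (1 - s) • distr G + mixture P c) ↔
      (1 - s)⁻¹ • (a - c) ∈ stdSimplex ℝ (Fin L) := by
  have hs' : 1 - s ≠ 0 := (sub_pos.2 hs).ne'
  constructor
  · rintro ⟨G, hG⟩
    refine hP.mem_stdSimplex (H := G) ?_
    rw [map_smul, map_sub, hG, add_sub_cancel_right, smul_smul, inv_mul_cancel₀ hs', one_smul]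
  · intro h
    obtain ⟨G, hG⟩ := exists_mixture_eq_distr (P := P) h
    refine ⟨G, ?_⟩
    rw [← hG, map_smul, map_sub, smul_smul, mul_inv_cancel₀ hs', one_smul, sub_add_cancel]

theorem JointlyIrreducible.kappa_mixture (hP : JointlyIrreducible P) {a b : Fin L → ℝ}
    (ha : a ∈ stdSimplex ℝ (Fin L)) (hb : b ∈ stdSimplex ℝ (Fin L)) :
    kappa (mixture P a) (mixture P b) = coordKappa a b := by
  refine IsGreatest.csSup_eq ⟨⟨coordKappa_nonneg ha hb, coordKappa_le_one ha hb, ?_⟩, ?_⟩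
  · by_cases hab : a = b
    · have h1 : coordKappa a b = 1 := le_antisymm (coordKappa_le_one ha hb)
        (le_coordKappa hb le_rfl fun j => by rw [hab, one_mul])
      obtain ⟨G, -⟩ := exists_mixture_eq_distr (P := P) ha
      exact ⟨G, by rw [h1, hab]; simp⟩
    · have := (hP.exists_eq_smul_add_iff a (coordKappa a b • b) (coordKappa_lt_one ha hb hab)).2
        (coordResidue_mem_stdSimplex ha hb hab)
      simpa only [map_smul] using this
  · rintro κ ⟨-, h1, G, hG⟩
    refine le_coordKappa hb h1 fun j => ?_
    rcases h1.eq_or_lt with h1 | h1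
    · have hab : a = b := hP.mixture_injective (by rw [hG, h1]; simp)
      rw [h1, hab, one_mul]
    · rw [← map_smul] at hG
      have := ((hP.exists_eq_smul_add_iff a (κ • b) h1).1 ⟨G, hG⟩).1 j
      exact sub_nonneg.1 (nonneg_of_mul_nonneg_right this (inv_pos.2 (sub_pos.2 h1)))

theorem JointlyIrreducible.residue_mixture (hP : JointlyIrreducible P) {a b : Fin L → ℝ}
    (ha : a ∈ stdSimplex ℝ (Fin L)) (hb : b ∈ stdSimplex ℝ (Fin L)) :
    residue (mixture P a) (mixture P b) = mixture P (coordResidue a b) := by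
  rw [residue, coordResidue, hP.kappa_mixture ha hb, map_smul, map_sub, map_smul]

theorem JointlyIrreducible.faceTest_mixture_iff (hP : JointlyIrreducible P) {K : ℕ}
    {R : Fin K → Fin L → ℝ} (hR : ∀ i, R i ∈ stdSimplex ℝ (Fin L)) :
    FaceTest (fun i => mixture P (R i)) ↔ CoordFaceTest R := by
  simp only [FaceTest, CoordFaceTest, hP.kappa_mixture (hR _) (hR _)]

section Loop

variable {m : ℕ} {F : Finset (Fin L)} {S : Fin (m + 3) → Fin L → ℝ} {w : Fin (m + 2) → ℝ} {n : ℕ}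

theorem loopMix_mixture (i : Fin (m + 2)) :
    loopMix (fun i => mixture P (S i)) (hullPoint (fun i => mixture P (S i)) w) n i =
      mixture P (coordLoopMix S w n i) := by
  simp only [loopMix, hullPoint, coordLoopMix, map_add, map_smul, map_sum]

theorem JointlyIrreducible.loopResidue_mixture (hP : JointlyIrreducible P)
    (hS : ∀ i, S i ∈ stdSimplex ℝ (Fin L)) (hw : w ∈ stdSimplex ℝ (Fin (m + 2))) (hn : 2 ≤ n) :
    loopResidue (fun i => mixture P (S i)) (hullPoint (fun i => mixture P (S i)) w) n =
      fun i => mixture P (coordLoopResidue S w n i) := by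
  funext i
  rw [loopResidue, loopMix_mixture,
    hP.residue_mixture (coordLoopMix_mem_stdSimplex hS hw hn i) (hS 0)]
  rfl

theorem JointlyIrreducible.loopStops_mixture_iff (hP : JointlyIrreducible P) (hS : IsFrame F S)
    (hw : w ∈ stdSimplex ℝ (Fin (m + 2))) :
    LoopStops (fun i => mixture P (S i)) (hullPoint (fun i => mixture P (S i)) w) n ↔
      CoordLoopStops S w n := by
  have hface : ∀ k, 2 ≤ k → (FaceTest (loopResidue (fun i => mixture P (S i))
      (hullPoint (fun i => mixture P (S i)) w) k) ↔ CoordFaceTest (coordLoopResidue S w k)) := by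
    intro k hk
    rw [hP.loopResidue_mixture hS.mem_stdSimplex hw hk]
    exact hP.faceTest_mixture_iff fun i => coordResidue_mem_stdSimplex
      (coordLoopMix_mem_stdSimplex hS.mem_stdSimplex hw hk i) (hS.mem_stdSimplex 0)
      (coordLoopMix_ne hS.linearIndependent i)
  have hne : ∀ k i, loopMix (fun i => mixture P (S i))
      (hullPoint (fun i => mixture P (S i)) w) k i ≠ mixture P (S 0) := by
    intro k i
    rw [loopMix_mixture]
    exact hP.mixture_injective.ne (coordLoopMix_ne hS.linearIndependent i)
  constructor
  · rintro ⟨h2, -, hf, hmin⟩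
    exact ⟨h2, (hface n h2).1 hf, fun k hk hkn h => hmin k hk hkn ((hface k hk).2 h)⟩
  · rintro ⟨h2, hf, hmin⟩
    exact ⟨h2, fun k _ _ i => hne k i, (hface n h2).2 hf,
      fun k hk hkn h => hmin k hk hkn ((hface k hk).1 h)⟩

end Loop

/-- If all but one of the components of a mixture are known, the solution is the missing one: the
maximal feasible `ν` removes the whole share of the known components. -/
theorem JointlyIrreducible.isSolution_iff (hP : JointlyIrreducible P) {K : ℕ} {b : Fin L → ℝ}
    (hb : b ∈ stdSimplex ℝ (Fin L)) {e : Fin K → Fin L} (he : Function.Injective e) {j : Fin L}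
    (hje : ∀ i, e i ≠ j) (hbj : 0 < b j) (hzero : ∀ l, l ≠ j → (∀ i, e i ≠ l) → b l = 0)
    (G : SignedMeasure X) :
    IsSolution (mixture P b) (fun i => distr (P (e i))) G ↔ G = distr (P j) := by
  let E : (Fin K → ℝ) → Fin L → ℝ := fun ν => ∑ i, ν i • Pi.single (e i) 1
  have hE : ∀ ν, ∑ i, ν i • distr (P (e i)) = mixture P (E ν) := fun ν => by
    simp [E, map_sum]
  have hEe : ∀ ν i, E ν (e i) = ν i := fun ν i => by
    simp [E, Finset.sum_apply, Pi.single_apply, he.eq_iff]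
  have hE0 : ∀ ν l, (∀ i, e i ≠ l) → E ν l = 0 := fun ν l hl => by
    simp [E, Finset.sum_apply, (hl _).symm]
  have hEsum : ∀ ν, ∑ l, E ν l = ∑ i, ν i := fun ν => by
    simp only [E, Finset.sum_apply]
    rw [Finset.sum_comm]
    simp [Pi.single_apply]
  have hbE : b = E (b ∘ e) + b j • Pi.single j 1 := by
    funext l
    by_cases hl : l = j
    · simp [hl, hE0 _ j hje]
    · by_cases hl' : ∃ i, e i = l
      · obtain ⟨i, rfl⟩ := hl'
        simp [hEe, hl]
      · push Not at hl'
        simp [hzero l hl hl', hE0 _ l hl', hl]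
  have hsum : ∑ i, b (e i) = 1 - b j := by
    have h := congrArg (fun v : Fin L → ℝ => ∑ l, v l) hbE
    simp only [Pi.add_apply, Finset.sum_add_distrib, hEsum, hb.2, Pi.smul_apply, smul_eq_mul,
      ← Finset.mul_sum, Function.comp_apply] at h
    simp only [Pi.single_apply, Finset.sum_ite_eq', Finset.mem_univ,
      if_true, mul_one] at h
    linarith
  have hfeas : ∀ ν, Feasible (mixture P b) (fun i => distr (P (e i))) ν ↔
      ∀ i, 0 ≤ ν i ∧ ν i ≤ b (e i) := by
    intro ν
    simp only [Feasible, hE]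
    constructor
    · rintro ⟨h0, h1, G, hG⟩
      rcases h1.eq_or_lt with h1 | h1
      · have hbν : b = E ν := hP.mixture_injective (by rw [hG, h1]; simp)
        rw [hbν, hE0 ν j hje] at hbj
        exact absurd hbj (lt_irrefl _)
      · intro i
        have := ((hP.exists_eq_smul_add_iff b (E ν) h1).1 ⟨G, hG⟩).1 (e i)
        have := sub_nonneg.1 (nonneg_of_mul_nonneg_right this (inv_pos.2 (sub_pos.2 h1)))
        exact ⟨h0 i, by rwa [hEe] at this⟩
    · intro h
      have h1 : ∑ i, ν i < 1 := by
        have := Finset.sum_le_sum fun i (_ : i ∈ Finset.univ) => (h i).2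
        linarith
      have hpos := sub_pos.2 h1
      refine ⟨fun i => (h i).1, h1.le, (hP.exists_eq_smul_add_iff b (E ν) h1).2 ⟨fun l => ?_, ?_⟩⟩
      · refine mul_nonneg (inv_nonneg.2 hpos.le) (sub_nonneg.2 ?_)
        by_cases hl : ∃ i, e i = l
        · obtain ⟨i, rfl⟩ := hl
          rw [hEe]
          exact (h i).2
        · push Not at hl
          rw [hE0 ν l hl]
          exact hb.1 l
      · simp only [Pi.smul_apply, Pi.sub_apply, smul_eq_mul]
        rw [← Finset.mul_sum, Finset.sum_sub_distrib, hb.2, hEsum, inv_mul_cancel₀ hpos.ne']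
  have hmax : (1 - ∑ i, b (e i))⁻¹ •
      (mixture P b - ∑ i, b (e i) • distr (P (e i))) = distr (P j) := by
    have hdiff : mixture P b - ∑ i, b (e i) • distr (P (e i)) = b j • distr (P j) := by
      have h := hE (b ∘ e)
      simp only [Function.comp_apply] at h
      rw [h, sub_eq_iff_eq_add', ← mixture_single P j, ← map_smul, ← map_add, ← hbE]
    rw [hdiff, hsum, sub_sub_cancel, smul_smul, inv_mul_cancel₀ hbj.ne', one_smul]
  have hfe : Feasible (mixture P b) (fun i => distr (P (e i))) (b ∘ e) :=
    (hfeas _).2 fun i => ⟨hb.1 _, le_rfl⟩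
  constructor
  · rintro ⟨ν, hν, hνmax, -, rfl⟩
    have hle := fun i => ((hfeas ν).1 hν i).2
    have heq : ν = fun i => b (e i) := by
      funext i
      exact (Finset.sum_eq_sum_iff_of_le fun i _ => hle i).1
        (le_antisymm (Finset.sum_le_sum fun i _ => hle i) (hνmax _ hfe)) i (Finset.mem_univ i)
    rw [heq]
    exact hmax
  · rintro rfl
    refine ⟨b ∘ e, hfe, fun ν' hν' => ?_, ?_, hmax.symm⟩
    · exact Finset.sum_le_sum fun i _ => ((hfeas ν').1 hν' i).2
    · simp only [Function.comp_apply, hsum]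
      linarith

/-! ### Correctness of the recursion -/

theorem eq_single_of_mem_stdSimplex {a : Fin L → ℝ} (ha : a ∈ stdSimplex ℝ (Fin L)) {k : Fin L}
    (h : ∀ l, l ≠ k → a l = 0) : a = Pi.single k 1 := by
  have hk : a k = 1 := by
    rw [← ha.2]
    exact (Finset.sum_eq_single k (fun l _ hl => h l hl) (by simp)).symm
  funext l
  by_cases hl : l = k
  · simp [hl, hk]
  · simp [hl, h l hl]

/-- Two points of an edge have the end points of the edge as their residues. -/
theorem IsFrame.exists_coordResidue_eq_single {F : Finset (Fin L)} {S : Fin 2 → Fin L → ℝ}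
    (hS : IsFrame F S) : ∃ j ∈ F, ∃ k ∈ F, j ≠ k ∧
      coordResidue (S 0) (S 1) = Pi.single j 1 ∧ coordResidue (S 1) (S 0) = Pi.single k 1 := by
  have hne : S 0 ≠ S 1 := hS.linearIndependent.injective.ne (by decide)
  have h0 := hS.mem_stdSimplex 0
  have h1 := hS.mem_stdSimplex 1
  obtain ⟨k, hk, hk'⟩ := exists_eq_coordKappa_mul h0 h1 hne
  obtain ⟨j, hj, hj'⟩ := exists_eq_coordKappa_mul h1 h0 hne.symm
  have hkF : k ∈ F := by
    by_contra h
    exact hk.ne' (hS.eq_zero 1 k h)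
  have hjF : j ∈ F := by
    by_contra h
    exact hj.ne' (hS.eq_zero 0 j h)
  have hjk : j ≠ k := by
    rintro rfl
    have hlt1 := mul_lt_of_lt_one_left hk (coordKappa_lt_one h0 h1 hne)
    have hlt2 := mul_lt_of_lt_one_left hj (coordKappa_lt_one h1 h0 hne.symm)
    rw [← hk'] at hlt1
    rw [← hj'] at hlt2
    exact lt_asymm hlt1 hlt2
  have hF : F = {j, k} := by
    refine (Finset.eq_of_subset_of_card_le (fun l hl => ?_) ?_).symm
    · rcases Finset.mem_insert.1 hl with rfl | hl
      · exact hjF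
      · rwa [Finset.mem_singleton.1 hl]
    · rw [hS.card_eq, Finset.card_pair hjk]
  have hout : ∀ l, l ≠ j → l ≠ k → ∀ i, S i l = 0 := fun l hlj hlk i =>
    hS.eq_zero i l (by simp [hF, hlj, hlk])
  refine ⟨j, hjF, k, hkF, hjk, ?_, ?_⟩
  · refine eq_single_of_mem_stdSimplex (coordResidue_mem_stdSimplex h0 h1 hne) fun l hl => ?_
    by_cases hlk : l = k
    · rw [hlk]
      exact coordResidue_eq_zero hk'
    · exact coordResidue_eq_zero_of_eq_zero (hout l hl hlk 0) (hout l hl hlk 1)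
  · refine eq_single_of_mem_stdSimplex (coordResidue_mem_stdSimplex h1 h0 hne.symm) fun l hl => ?_
    by_cases hlj : l = j
    · rw [hlj]
      exact coordResidue_eq_zero hj'
    · exact coordResidue_eq_zero_of_eq_zero (hout l hlj hl 1) (hout l hlj hl 0)

/-- For good random choices, a run on a frame of a face returns, and it can only return the vertices
of that face, each of them once. -/
theorem JointlyIrreducible.demixReturns_of_good (hP : JointlyIrreducible P) :
    ∀ {K : ℕ} {F : Finset (Fin L)} {S : Fin K → Fin L → ℝ}, 2 ≤ K → IsFrame F S →
      ∀ {ω : Draws K}, Good K S ω →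
        (∃ Q, DemixReturns K (fun i => mixture P (S i)) ω Q) ∧
        ∀ Q, DemixReturns K (fun i => mixture P (S i)) ω Q →
          ∃ e : Fin K → Fin L, Function.Injective e ∧ (∀ i, e i ∈ F) ∧
            ∀ i, Q i = distr (P (e i))
  | 0, _, _, hK, _, _, _ => absurd hK (by norm_num)
  | 1, _, _, hK, _, _, _ => absurd hK (by norm_num)
  | 2, F, S, _, hS, ω, _ => by
    refine ⟨⟨_, hP.mixture_injective.ne
      (hS.linearIndependent.injective.ne (by decide)), rfl⟩, ?_⟩
    rintro Q ⟨-, rfl⟩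
    obtain ⟨j, hj, k, hk, hjk, h0, h1⟩ := hS.exists_coordResidue_eq_single
    refine ⟨![j, k], ?_, ?_, ?_⟩
    · intro i i' h
      fin_cases i <;> fin_cases i' <;> simp_all
    · intro i
      fin_cases i
      · exact hj
      · exact hk
    · have h0' := hP.residue_mixture (hS.mem_stdSimplex 0) (hS.mem_stdSimplex 1)
      have h1' := hP.residue_mixture (hS.mem_stdSimplex 1) (hS.mem_stdSimplex 0)
      rw [h0, mixture_single] at h0'
      rw [h1, mixture_single] at h1'
      intro i
      fin_cases i
      · exact h0'
      · exact h1'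
  | m + 3, F, S, _, hS, ω, hω => by
    obtain ⟨hw, n, hn, hgood⟩ := hω
    obtain ⟨k, hk, hR⟩ := hn.exists_isFrame_erase hS hw
    obtain ⟨hex, hall⟩ := hP.demixReturns_of_good (by omega) hR hgood
    rw [← hP.loopResidue_mixture hS.mem_stdSimplex hw hn.1] at hex hall
    set b : Fin L → ℝ := ∑ i, (1 / ((m : ℝ) + 3)) • S i with hb
    have hpos : 0 < 1 / ((m : ℝ) + 3) := by positivity
    have hbmem : b ∈ stdSimplex ℝ (Fin L) := by
      refine sum_smul_mem_stdSimplex hS.mem_stdSimplex (w := fun _ => 1 / ((m : ℝ) + 3))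
        ⟨fun _ => hpos.le, ?_⟩
      simp only [Finset.sum_const, Finset.card_univ, Fintype.card_fin, nsmul_eq_mul]
      push_cast
      field_simp
    have hbk : 0 < b k := by
      obtain ⟨i, hi⟩ := hS.exists_pos hk
      simp only [hb, Finset.sum_apply, Pi.smul_apply, smul_eq_mul]
      exact Finset.sum_pos' (fun i _ => mul_nonneg hpos.le ((hS.mem_stdSimplex i).1 k))
        ⟨i, Finset.mem_univ i, mul_pos hpos hi⟩
    have hmean : (1 / ((m : ℝ) + 3)) • ∑ i, mixture P (S i) = mixture P b := by
      simp only [hb, map_sum, map_smul, Finset.smul_sum]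
    -- The last step of the run can only return the vertex that is missing in the facet.
    have hsol : ∀ {e : Fin (m + 2) → Fin L}, Function.Injective e → (∀ i, e i ∈ F.erase k) →
        ∀ G, IsSolution ((1 / ((m : ℝ) + 3)) • ∑ i, mixture P (S i)) (fun i => distr (P (e i))) G ↔
          G = distr (P k) := by
      intro e he heF G
      rw [hmean]
      refine hP.isSolution_iff hbmem he (fun i => (Finset.mem_erase.1 (heF i)).1) hbk ?_ G
      intro l hlk hl
      have himage : Finset.univ.image e = F.erase k := by
        refine Finset.eq_of_subset_of_card_le (fun x hx => ?_) ?_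
        · obtain ⟨i, -, rfl⟩ := Finset.mem_image.1 hx
          exact heF i
        · rw [hR.card_eq, Finset.card_image_of_injective _ he, Finset.card_univ, Fintype.card_fin]
      have hlF : l ∉ F := by
        intro hlF
        have : l ∈ Finset.univ.image e := himage ▸ Finset.mem_erase.2 ⟨hlk, hlF⟩
        obtain ⟨i, -, hi⟩ := Finset.mem_image.1 this
        exact hl i hi
      simp [hb, Finset.sum_apply, hS.eq_zero _ l hlF]
    constructor
    · obtain ⟨Q', hQ'⟩ := hex
      obtain ⟨e, he, heF, heQ⟩ := hall Q' hQ'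
      obtain rfl : Q' = fun i => distr (P (e i)) := funext heQ
      exact ⟨_, n, (hP.loopStops_mixture_iff hS hw).2 hn, _, hQ', _, (hsol he heF _).2 rfl, rfl⟩
    · rintro Q ⟨n', hn', Q', hQ', G, hG, rfl⟩
      obtain rfl := hn.unique ((hP.loopStops_mixture_iff hS hw).1 hn')
      obtain ⟨e, he, heF, heQ⟩ := hall Q' hQ'
      obtain rfl : Q' = fun i => distr (P (e i)) := funext heQ
      obtain rfl := (hsol he heF G).1 hG
      refine ⟨Fin.snoc (α := fun _ => Fin L) e k, ?_, ?_, ?_⟩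
      · refine Fin.snoc_injective_of_injective he ?_
        rintro ⟨i, hi⟩
        exact (Finset.mem_erase.1 (heF i)).1 hi
      · refine Fin.lastCases ?_ fun i => ?_
        · simpa using hk
        · simpa using (Finset.mem_erase.1 (heF i)).2
      · refine Fin.lastCases ?_ fun i => ?_
        · simp
        · simp

theorem isFrame_univ_of_rank_eq {Pi : Matrix (Fin L) (Fin L) ℝ} (hnonneg : ∀ i j, 0 ≤ Pi i j)
    (hsum : ∀ i, ∑ j, Pi i j = 1) (hrank : Pi.rank = L) :
    IsFrame Finset.univ Pi.row where
  mem_stdSimplex i := ⟨hnonneg i, hsum i⟩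
  eq_zero _ j hj := absurd (Finset.mem_univ j) hj
  linearIndependent := by
    refine linearIndependent_iff_card_eq_finrank_span.2 ?_
    rw [Fintype.card_fin]
    exact hrank.symm.trans Pi.rank_eq_finrank_span_row
  card_eq := by simp

end Mixtures

end Demixing

end

theorem mainTheorem1 {X : Type*} [MeasurableSpace X] (L : ℕ) (hL : 2 ≤ L)
    (P : Fin L → ProbabilityMeasure X) (hP : Demixing.JointlyIrreducible P)
    (Pi : Matrix (Fin L) (Fin L) ℝ)
    (hPi_nonneg : ∀ i j, 0 ≤ Pi i j) (hPi_sum : ∀ i, ∑ j, Pi i j = 1)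
    (hPi_rank : Pi.rank = L) :
    ∀ᵐ ω ∂(Demixing.drawLaw L),
      (∃ Q, Demixing.DemixReturns L (Demixing.contaminated Pi P) ω Q) ∧
      ∀ Q, Demixing.DemixReturns L (Demixing.contaminated Pi P) ω Q →
        ∃ σ : Equiv.Perm (Fin L), ∀ i, Q i = Demixing.distr (P (σ i)) := by
  have hS := Demixing.isFrame_univ_of_rank_eq hPi_nonneg hPi_sum hPi_rank
  filter_upwards [hS.ae_good] with ω hω
  obtain ⟨hex, hall⟩ := hP.demixReturns_of_good hL hS hω
  refine ⟨hex, fun Q hQ => ?_⟩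
  obtain ⟨e, he, -, heQ⟩ := hall Q hQ
  exact ⟨Equiv.ofBijective e (Finite.injective_iff_bijective.1 he), heQ⟩
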